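/- A dimaze $(D,B_0)$ is a (possibly infinite) digraph $D$ without loops or parallel edges together with a set $B_0$ of sinks of $D$, called exits. A set $A\subseteq V(D)$ is linkable if there is a set of pairwise vertex-disjoint finite directed paths, each ending in $B_0$, whose set of initial vertices is $A$. Matroids may be infinite. If the linkable sets are the independent sets of a matroid $M_L(D,B_0)$ on $V(D)$, then every matroid isomorphic to a restriction $M_L(D,B_0)|X$ with $X\subseteq V(D)$ is called a gammoid, and $(D,B_0)$ is called a presentation of it. An outgoing comb in $(D,B_0)$ consists of a forward oriented ray of $D$ and infinitely many pairwise disjoint non-trivial finite directed paths of $D$, each of which meets the ray precisely in its initial vertex and ends in $B_0$. A gammoid is $C^O$-free if it has a presentation that contains no outgoing comb. **Theorem.** The class of $C^O$-free gammoids is minor-closed: if $M$ is a $C^O$-free gammoid and $C,R$ are disjoint subsets of its ground set, then the minor $M/C\setminus R$ is a $C^O$-free gammoid. -/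

import Mathlib

universe u v

/-- A dimaze `(D, B₀)` with vertex set `V`: a digraph without loops (and without parallel edges,
as the edges form a relation; the edges `(x, y)` and `(y, x)` may both be present), together with
a set of sinks, the exits. -/
structure Dimaze (V : Type v) extends Digraph V where
  /-- The set `B₀` of exits. -/
  exits : Set V
  loopless : ∀ x, ¬ Adj x x
  exits_sink : ∀ b ∈ exits, ∀ y, ¬ Adj b y

namespace Dimaze

variable {V : Type v} (D : Dimaze V)

/-- A (finite, directed) path of the digraph: a nonempty list of distinct vertices, each of which
has an edge to the next. A single vertex is a trivial path. -/
@[ext]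
structure DiPath where
  /-- The vertices, in the order of the path. -/
  verts : List V
  ne_nil : verts ≠ []
  chain : verts.IsChain D.Adj
  nodup : verts.Nodup

namespace DiPath

variable {D}

/-- The initial vertex `Ini(P)`. -/
def ini (P : D.DiPath) : V := P.verts.head P.ne_nil

/-- The terminal vertex `Ter(P)`. -/
def ter (P : D.DiPath) : V := P.verts.getLast P.ne_nil

/-- The vertex set `V(P)`. -/
def vertexSet (P : D.DiPath) : Set V := {x | x ∈ P.verts}

end DiPath

/-- A linkage: a set of pairwise vertex-disjoint paths ending in exits. -/
def IsLinkage (P : Set D.DiPath) : Prop :=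
  P.PairwiseDisjoint DiPath.vertexSet ∧ ∀ p ∈ P, p.ter ∈ D.exits

/-- A set of vertices is linkable if it is the set of initial vertices of a linkage. -/
def Linkable (A : Set V) : Prop :=
  ∃ P : Set D.DiPath, D.IsLinkage P ∧ DiPath.ini '' P = A

/-- A ray `R 0, R 1, R 2, …`: a one-way infinite, forward oriented path. -/
def IsRay (R : ℕ → V) : Prop :=
  Function.Injective R ∧ ∀ n, D.Adj (R n) (R (n + 1))

/-- The dimaze contains an outgoing comb: there are a ray `R` (the spine) and a set `S` of
infinitely many pairwise disjoint non-trivial paths (the spikes), each of which meets the ray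
precisely in its initial vertex and ends in an exit. -/
def HasOutgoingComb : Prop :=
  ∃ (R : ℕ → V) (S : Set D.DiPath), D.IsRay R ∧ S.Infinite ∧ D.IsLinkage S ∧
    ∀ p ∈ S, p.ini ≠ p.ter ∧ p.vertexSet ∩ Set.range R = {p.ini}

/-- `M_L(D, B₀)` is the matroid `N`: its ground set consists of all vertices and its independent
sets are the linkable sets. For some dimazes there is no such matroid. -/
def Defines (N : Matroid V) : Prop :=
  N.E = Set.univ ∧ ∀ I : Set V, N.Indep I ↔ D.Linkable I

end Dimaze

/-- Two matroids are isomorphic: some bijection between their ground sets preserves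
independence of sets in both directions. -/
def MatroidIsomorphic {α : Type u} {β : Type v} (M : Matroid α) (N : Matroid β) : Prop :=
  ∃ e : M.E ≃ N.E, ∀ I : Set M.E,
    M.Indep (Subtype.val '' I) ↔ N.Indep (Subtype.val '' (e '' I))

/-- `(D, B₀)` is a presentation of the gammoid `M`: the linkable sets form a matroid (that is,
`M_L(D, B₀)` is a strict gammoid) and `M` is, up to isomorphism, a restriction of it. -/
def Dimaze.Presents {α : Type u} {V : Type v} (D : Dimaze V) (M : Matroid α) : Prop :=
  ∃ (N : Matroid V) (X : Set V), D.Defines N ∧ MatroidIsomorphic M (N.restrict X)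

/-- A `C^O`-free gammoid: a matroid that has a presentation containing no outgoing comb. -/
def IsOutgoingCombFreeGammoid {α : Type u} (M : Matroid α) : Prop :=
  ∃ (V : Type v) (D : Dimaze V), ¬ D.HasOutgoingComb ∧ D.Presents M

/-! Deletion only shrinks the restricted set, so contraction is the issue, and contracting a basis
of `C` and deleting the rest reduces it to independent `C`. If `C` consists of exits, then cutting
`C` off from the digraph realises the contraction up to loops (`isolate_linkable_iff`). In general,
extend `C` to a base `B`, link `B` to the exits, and shift the dimaze along this linkage so that `B`
becomes the set of exits.

The shift must preserve linkable sets and comb-freeness. Linkages are encoded by successor maps.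
That of a base, `q`, is a bijection from the non-exits onto the complement of `B`, so composing with
`q` or its inverse carries successor maps between the two dimazes. Only termination of the paths can
fail, and a failure yields a ray. Without outgoing combs, rays of `D` eventually leave the linkage
(`Links.ray_eventually_avoids`), and by maximality of `B` so do rays of the shift
(`LinksBase.shift_ray_eventually_avoids`). Off the linkage `q` is the identity, so the ray's tail
would follow a path of the original linkage, which is finite. -/

open Function

namespace Dimaze

variable {V : Type v} {D : Dimaze V} {m q : V → V} {A B : Set V}

/-! ### Successor maps and the paths they trace -/

/-- `m` moves every vertex along an edge or not at all, and is injective off the exits. -/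
structure IsSuccMap (D : Dimaze V) (m : V → V) : Prop where
  step : ∀ x, m x = x ∨ D.Adj x (m x)
  -- Fixed points count too: no other non-exit may be mapped to a non-exit that stays put.
  injOn : Set.InjOn m D.exitsᶜ

/-- The vertices met by the iterates of `m` starting in `A`. -/
def orbit (m : V → V) (A : Set V) : Set V := {x | ∃ a ∈ A, ∃ n, m^[n] a = x}

/-- Following the successor map `m` links `A` to the exits. -/
structure Links (D : Dimaze V) (m : V → V) (A : Set V) : Prop extends D.IsSuccMap m where
  avoid : ∀ x ∉ D.exits, m x ∉ A
  reach : ∀ a ∈ A, ∃ n, m^[n] a ∈ D.exits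

theorem subset_orbit (m : V → V) (A : Set V) : A ⊆ orbit m A := fun a ha => ⟨a, ha, 0, rfl⟩

theorem iterate_mem_orbit {x : V} (hx : x ∈ orbit m A) (k : ℕ) : m^[k] x ∈ orbit m A := by
  obtain ⟨a, ha, n, rfl⟩ := hx
  exact ⟨a, ha, k + n, iterate_add_apply m k n a⟩

namespace IsSuccMap

theorem fixed (hm : D.IsSuccMap m) {b : V} (hb : b ∈ D.exits) : m b = b :=
  (hm.step b).resolve_right (D.exits_sink b hb _)

theorem adj (hm : D.IsSuccMap m) {x : V} (hx : m x ≠ x) : D.Adj x (m x) :=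
  (hm.step x).resolve_left hx

theorem iterate_mem_exits (hm : D.IsSuccMap m) {x : V} {n k : ℕ} (hn : m^[n] x ∈ D.exits)
    (hk : n ≤ k) : m^[k] x ∈ D.exits := by
  obtain ⟨d, rfl⟩ := Nat.exists_eq_add_of_le' hk
  rw [iterate_add_apply, iterate_fixed (hm.fixed hn)]
  exact hn

theorem iterate_not_mem_exits (hm : D.IsSuccMap m) {x : V} {n k : ℕ} (hn : m^[n] x ∉ D.exits)
    (hk : k ≤ n) : m^[k] x ∉ D.exits := fun h => hn (hm.iterate_mem_exits h hk)

/-- Injectivity off the exits lets common last steps be undone one at a time. This gives both the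
simplicity and the disjointness of traced paths. -/
theorem iterate_cancel (hm : D.IsSuccMap m) {x y : V} {i d : ℕ}
    (hx : ∀ k < i, m^[k] x ∉ D.exits) (hy : ∀ k < i + d, m^[k] y ∉ D.exits)
    (h : m^[i] x = m^[i + d] y) : x = m^[d] y := by
  induction i with
  | zero => simpa using h
  | succ i ih =>
    refine ih (fun k hk => hx k (by omega)) (fun k hk => hy k (by omega)) ?_
    rw [show i + 1 + d = (i + d) + 1 by omega, iterate_succ_apply', iterate_succ_apply'] at h
    exact hm.injOn (hx i (by omega)) (hy (i + d) (by omega)) h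

/-- The path traced by a successor map up to the first exit. -/
theorem exists_path (hm : D.IsSuccMap m) {a : V} (hreach : ∃ n, m^[n] a ∈ D.exits)
    (ha : ∀ k, m^[k] a ∉ D.exits → m^[k + 1] a ≠ a) :
    ∃ p : D.DiPath, p.ini = a ∧ p.ter ∈ D.exits ∧
      ∀ x ∈ p.vertexSet, ∃ k, m^[k] a = x ∧ ∀ i < k, m^[i] a ∉ D.exits := by
  classical
  have hlt : ∀ i < Nat.find hreach, m^[i] a ∉ D.exits := fun i hi => Nat.find_min hreach hi
  have hmem := Nat.find_spec hreach
  generalize Nat.find hreach = n at hlt hmem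
  have hinj : ∀ i j, i < j → j ≤ n → m^[i] a ≠ m^[j] a := by
    intro i j hij hj h
    obtain ⟨d, rfl⟩ := Nat.exists_eq_add_of_lt hij
    have := hm.iterate_cancel (d := d + 1) (fun k hk => hlt k (by omega))
      (fun k hk => hlt k (by omega)) h
    exact ha d (hlt d (by omega)) this.symm
  refine ⟨⟨(List.range (n + 1)).map (fun i => m^[i] a), by simp, ?_, ?_⟩, ?_, ?_, ?_⟩
  · rw [List.isChain_map, List.isChain_range_succ]
    intro i hi
    have := hinj i (i + 1) (by omega) (by omega)
    simp only [iterate_succ_apply'] at this ⊢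
    exact hm.adj this.symm
  · refine List.Nodup.map_on ?_ List.nodup_range
    intro i hi j hj h
    rw [List.mem_range] at hi hj
    rcases lt_trichotomy i j with hij | hij | hij
    · exact (hinj i j hij (by omega) h).elim
    · exact hij
    · exact (hinj j i hij (by omega) h.symm).elim
  · simp [DiPath.ini]
  · have hlast : ∀ h, ((List.range (n + 1)).map (fun i => m^[i] a)).getLast h = m^[n] a := by
      intro h
      rw [List.getLast_map, List.getLast_range, Nat.add_sub_cancel]
    exact (congrArg (· ∈ D.exits) (hlast _)).mpr hmem
  · intro x hx
    obtain ⟨i, hi, rfl⟩ := List.mem_map.1 hx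
    rw [List.mem_range] at hi
    exact ⟨i, rfl, fun k hk => hlt k (by omega)⟩

/-- The linkage traced by a successor map. -/
theorem exists_linkage (hm : D.IsSuccMap m) (hreach : ∀ a ∈ A, ∃ n, m^[n] a ∈ D.exits)
    (havoid : ∀ a ∈ A, ∀ k, m^[k] a ∉ D.exits → m^[k + 1] a ∉ A) :
    ∃ P : Set D.DiPath, D.IsLinkage P ∧ DiPath.ini '' P = A ∧
      ∀ p ∈ P, ∀ x ∈ p.vertexSet, ∃ k, m^[k] p.ini = x := by
  have key : ∀ a : A, ∃ p : D.DiPath, p.ini = a ∧ p.ter ∈ D.exits ∧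
      ∀ x ∈ p.vertexSet, ∃ k, m^[k] a = x ∧ ∀ i < k, m^[i] a ∉ D.exits := fun a =>
    hm.exists_path (hreach a a.2) (fun k hk h => havoid a a.2 k hk (by rw [h]; exact a.2))
  choose p hini hter hp using key
  have aux : ∀ (a a' : A) (i d : ℕ), (∀ k < i, m^[k] a ∉ D.exits) →
      (∀ k < i + d, m^[k] a' ∉ D.exits) → m^[i] (a : V) = m^[i + d] (a' : V) → a = a' := by
    intro a a' i d hi hd h
    have hc := hm.iterate_cancel hi hd h
    cases d with
    | zero => exact Subtype.ext hc
    | succ d => exact (havoid a' a'.2 d (hd d (by omega)) (hc ▸ a.2)).elim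
  refine ⟨Set.range p, ⟨?_, ?_⟩, ?_, ?_⟩
  · rintro _ ⟨a, rfl⟩ _ ⟨a', rfl⟩ hne
    rw [Function.onFun, Set.disjoint_left]
    intro x hx hx'
    obtain ⟨i, rfl, hi⟩ := hp a x hx
    obtain ⟨j, h, hj⟩ := hp a' _ hx'
    apply hne
    rcases le_total i j with hij | hij
    · obtain ⟨d, rfl⟩ := Nat.exists_eq_add_of_le hij
      rw [aux a a' i d hi hj h.symm]
    · obtain ⟨d, rfl⟩ := Nat.exists_eq_add_of_le hij
      rw [aux a' a j d hj hi h]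
  · rintro _ ⟨a, rfl⟩
    exact hter a
  · ext x
    constructor
    · rintro ⟨_, ⟨a, rfl⟩, rfl⟩
      rw [hini]
      exact a.2
    · intro hx
      exact ⟨p ⟨x, hx⟩, ⟨_, rfl⟩, hini _⟩
  · rintro _ ⟨a, rfl⟩ x hx
    obtain ⟨k, h, -⟩ := hp a x hx
    exact ⟨k, by rw [hini, h]⟩

end IsSuccMap

theorem Links.linkable (h : D.Links m A) : D.Linkable A := by
  obtain ⟨P, hP, hA, -⟩ := h.toIsSuccMap.exists_linkage h.reach
    (fun a _ k hk => by rw [iterate_succ_apply']; exact h.avoid _ hk)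
  exact ⟨P, hP, hA⟩

/-- The successor map along the paths of a linkage. -/
theorem IsLinkage.exists_links {P : Set D.DiPath} (hP : D.IsLinkage P) :
    ∃ m, D.Links m (DiPath.ini '' P) ∧
      ∀ x, m x ≠ x → x ∈ orbit m (DiPath.ini '' P) ∧ ∃ p ∈ P, x ∈ p.vertexSet := by
  classical
  obtain ⟨hdisj, hter⟩ := hP
  let S : V → V → Prop := fun x y =>
    ∃ p ∈ P, ∃ i, p.verts[i]? = some x ∧ p.verts[i + 1]? = some y
  have same : ∀ p ∈ P, ∀ p' ∈ P, ∀ (i j : ℕ) (x : V), p.verts[i]? = some x → p'.verts[j]? = some x →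
      p = p' ∧ i = j := by
    intro p hp p' hp' i j x hi hj
    have hpp : p = p' := by
      by_contra hne
      exact Set.disjoint_left.1 (hdisj hp hp' hne) (List.mem_of_getElem? hi)
        (List.mem_of_getElem? hj)
    subst hpp
    obtain ⟨hi', -⟩ := List.getElem?_eq_some_iff.1 hi
    exact ⟨rfl, (List.getElem?_inj hi' p.nodup).1 (hi.trans hj.symm)⟩
  have hfun : ∀ x y y', S x y → S x y' → y = y' := by
    rintro x y y' ⟨p, hp, i, h1, h2⟩ ⟨p', hp', j, h3, h4⟩
    obtain ⟨rfl, rfl⟩ := same p hp p' hp' i j x h1 h3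
    simpa using h2.symm.trans h4
  have hinj : ∀ x x' y, S x y → S x' y → x = x' := by
    rintro x x' y ⟨p, hp, i, h1, h2⟩ ⟨p', hp', j, h3, h4⟩
    obtain ⟨rfl, hij⟩ := same p hp p' hp' _ _ y h2 h4
    obtain rfl : i = j := by omega
    simpa using h1.symm.trans h3
  have hadj : ∀ x y, S x y → D.Adj x y := by
    rintro x y ⟨p, hp, i, h1, h2⟩
    obtain ⟨hi', rfl⟩ := List.getElem?_eq_some_iff.1 h1
    obtain ⟨hj', rfl⟩ := List.getElem?_eq_some_iff.1 h2
    exact List.isChain_iff_getElem.1 p.chain i hj'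
  have hsucc : ∀ p ∈ P, ∀ (i : ℕ) (x : V), p.verts[i]? = some x → x ∉ D.exits → ∃ y, S x y := by
    intro p hp i x h1 hx
    obtain ⟨hi', rfl⟩ := List.getElem?_eq_some_iff.1 h1
    by_cases hj : i + 1 < p.verts.length
    · exact ⟨p.verts[i + 1], p, hp, i, h1, List.getElem?_eq_getElem hj⟩
    · refine (hx ?_).elim
      have := hter p hp
      rw [DiPath.ter, List.getLast_eq_getElem] at this
      convert this using 2
      omega
  have hini : ∀ p : D.DiPath, p.verts[0]? = some p.ini := by
    intro p
    rw [DiPath.ini, List.head_eq_getElem]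
    exact List.getElem?_eq_getElem _
  let m : V → V := fun x => if h : ∃ y, S x y then h.choose else x
  have hmS : ∀ x y, S x y → m x = y := by
    intro x y h
    have hex : ∃ y, S x y := ⟨y, h⟩
    have : m x = hex.choose := dif_pos hex
    rw [this]
    exact hfun _ _ _ hex.choose_spec h
  have hm' : ∀ x, (¬ ∃ y, S x y) → m x = x := fun x h => dif_neg h
  have hiter : ∀ p ∈ P, ∀ (i : ℕ) (x : V), p.verts[i]? = some x → m^[i] p.ini = x := by
    intro p hp i
    induction i with
    | zero =>
      intro x hx
      simpa using (hini p).symm.trans hx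
    | succ i ih =>
      intro x hx
      obtain ⟨hi', -⟩ := List.getElem?_eq_some_iff.1 hx
      have h0 : p.verts[i]? = some p.verts[i] := List.getElem?_eq_getElem (by omega)
      rw [iterate_succ_apply', ih _ h0]
      exact hmS _ _ ⟨p, hp, i, h0, hx⟩
  refine ⟨m, ⟨⟨?_, ?_⟩, ?_, ?_⟩, ?_⟩
  · intro x
    by_cases h : ∃ y, S x y
    · obtain ⟨y, hy⟩ := h
      right
      rw [hmS x y hy]
      exact hadj x y hy
    · exact Or.inl (hm' x h)
  -- A path of the linkage can stop only at an exit, so it never runs into a non-exit fixed by `m`.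
  · have mixed : ∀ x y, S x y → y ∉ D.exits → (¬ ∃ z, S y z) → False := by
      rintro x y ⟨p, hp, i, h1, h2⟩ hy hz
      exact hz (hsucc p hp _ y h2 hy)
    intro x hx x' hx' h
    by_cases h1 : ∃ y, S x y <;> by_cases h2 : ∃ y, S x' y
    · obtain ⟨y, hy⟩ := h1
      obtain ⟨y', hy'⟩ := h2
      rw [hmS _ _ hy, hmS _ _ hy'] at h
      exact hinj _ _ _ hy (h ▸ hy')
    · obtain ⟨y, hy⟩ := h1
      rw [hmS _ _ hy, hm' _ h2] at h
      exact (mixed x x' (h ▸ hy) hx' h2).elim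
    · obtain ⟨y, hy⟩ := h2
      rw [hmS _ _ hy, hm' _ h1] at h
      exact (mixed x' x (h ▸ hy) hx h1).elim
    · rwa [hm' _ h1, hm' _ h2] at h
  · rintro x hx ⟨p', hp', hpx⟩
    by_cases h : ∃ y, S x y
    · obtain ⟨y, hy⟩ := h
      rw [hmS _ _ hy] at hpx
      obtain ⟨p, hp, i, h1, h2⟩ := hy
      have := (same p hp p' hp' _ _ y h2 (hpx ▸ hini p')).2
      omega
    · rw [hm' _ h] at hpx
      exact h (hsucc p' hp' 0 x (hpx ▸ hini p') hx)
  · rintro _ ⟨p, hp, rfl⟩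
    have hpos := List.length_pos_iff.2 p.ne_nil
    refine ⟨p.verts.length - 1, ?_⟩
    rw [hiter p hp _ p.ter]
    · exact hter p hp
    · rw [DiPath.ter, List.getLast_eq_getElem]
      exact List.getElem?_eq_getElem _
  · intro x hx
    by_cases h : ∃ y, S x y
    · obtain ⟨y, p, hp, i, h1, h2⟩ := h
      exact ⟨⟨p.ini, ⟨p, hp, rfl⟩, i, hiter p hp i x h1⟩, p, hp, List.mem_of_getElem? h1⟩
    · exact (hx (hm' x h)).elim

theorem Linkable.exists_links (h : D.Linkable A) :
    ∃ m, D.Links m A ∧ ∀ x, m x ≠ x → x ∈ orbit m A := by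
  obtain ⟨P, hP, rfl⟩ := h
  obtain ⟨m, hm, hm'⟩ := hP.exists_links
  exact ⟨m, hm, fun x hx => (hm' x hx).1⟩

/-! ### Rays and outgoing combs -/

/-- A ray, infinitely many vertices of which are linked to the exits by a successor map whose
iterates do not return to the ray, yields an outgoing comb. -/
theorem IsSuccMap.hasOutgoingComb (hm : D.IsSuccMap m) {R : ℕ → V} (hR : D.IsRay R)
    {S : Set V} (hS : S.Infinite) (hSR : S ⊆ Set.range R)
    (hreach : ∀ s ∈ S, ∃ n, m^[n] s ∈ D.exits)
    (hret : ∀ s ∈ S, ∀ k, m^[k + 1] s ∉ Set.range R) : D.HasOutgoingComb := by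
  obtain ⟨P, hP, rfl, hPm⟩ := hm.exists_linkage hreach
    (fun s hs k _ h => hret s hs k (hSR h))
  refine ⟨R, P, hR, hS.of_image _, hP, fun p hp => ?_⟩
  have hpR : p.ini ∈ Set.range R := hSR ⟨p, hp, rfl⟩
  have hmem : p.ini ∈ p.vertexSet := List.head_mem _
  refine ⟨fun h => ?_, ?_⟩
  · obtain ⟨n, hn⟩ := hpR
    have := hP.2 p hp
    rw [← h, ← hn] at this
    exact D.exits_sink _ this _ (hR.2 n)
  · ext x
    constructor
    · rintro ⟨hx, hxR⟩
      obtain ⟨k, rfl⟩ := hPm p hp x hx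
      cases k with
      | zero => rfl
      | succ k => exact (hret _ ⟨p, hp, rfl⟩ k hxR).elim
    · rintro rfl
      exact ⟨hmem, hpR⟩

theorem IsRay.not_mem_exits {R : ℕ → V} (hR : D.IsRay R) (n : ℕ) : R n ∉ D.exits :=
  fun h => D.exits_sink _ h _ (hR.2 n)

theorem IsRay.tail {R : ℕ → V} (hR : D.IsRay R) (N : ℕ) : D.IsRay (fun n => R (N + n)) :=
  ⟨fun _ _ h => Nat.add_left_cancel (hR.1 h), fun n => hR.2 (N + n)⟩

theorem Links.eq_of_iterate_eq (h : D.Links m A) {a a' : V} (ha : a ∈ A) (ha' : a' ∈ A)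
    {i j : ℕ} (hij : m^[i] a = m^[j] a') (hi : m^[i] a ∉ D.exits) : a = a' := by
  have aux : ∀ a ∈ A, ∀ a' ∈ A, ∀ i d : ℕ, m^[i] a = m^[i + d] a' → m^[i] a ∉ D.exits →
      a = a' := by
    intro a ha a' ha' i d hd hi
    have hd' : m^[i + d] a' ∉ D.exits := hd ▸ hi
    have := h.iterate_cancel (fun k hk => h.iterate_not_mem_exits hi hk.le)
      (fun k hk => h.iterate_not_mem_exits hd' hk.le) hd
    cases d with
    | zero => exact this
    | succ d =>
      rw [iterate_succ_apply'] at this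
      exact (h.avoid _ (h.iterate_not_mem_exits hd' (by omega)) (this ▸ ha)).elim
  rcases le_total i j with hle | hle
  · obtain ⟨d, rfl⟩ := Nat.exists_eq_add_of_le hle
    exact aux a ha a' ha' i d hij hi
  · obtain ⟨d, rfl⟩ := Nat.exists_eq_add_of_le hle
    exact (aux a' ha' a ha j d hij.symm (hij ▸ hi)).symm

theorem IsSuccMap.finite_orbit_singleton (hm : D.IsSuccMap m) {a : V} {n : ℕ}
    (hn : m^[n] a ∈ D.exits) : (orbit m {a}).Finite := by
  refine ((Set.finite_Iic n).image (fun k => m^[k] a)).subset ?_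
  rintro _ ⟨_, rfl, k, rfl⟩
  rcases le_total k n with hk | hk
  · exact ⟨k, hk, rfl⟩
  · refine ⟨n, le_refl n, ?_⟩
    obtain ⟨d, rfl⟩ := Nat.exists_eq_add_of_le' hk
    simp only [iterate_add_apply]
    exact (iterate_fixed (hm.fixed hn) d).symm

theorem IsSuccMap.isRay (hm : D.IsSuccMap m) {a : V} (ha : ∀ x ∉ D.exits, m x ≠ a)
    (hn : ∀ n, m^[n] a ∉ D.exits) : D.IsRay (fun n => m^[n] a) := by
  have hinj : ∀ i d, m^[i] a ≠ m^[i + (d + 1)] a := by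
    intro i d h
    have := hm.iterate_cancel (fun k _ => hn k) (fun k _ => hn k) h
    rw [iterate_succ_apply'] at this
    exact ha _ (hn d) this.symm
  refine ⟨fun i j h => ?_, fun n => ?_⟩
  · rcases lt_trichotomy i j with hij | hij | hij
    · obtain ⟨d, rfl⟩ := Nat.exists_eq_add_of_lt hij
      exact (hinj i d h).elim
    · exact hij
    · obtain ⟨d, rfl⟩ := Nat.exists_eq_add_of_lt hij
      exact (hinj j d h.symm).elim
  · have := hinj n 0
    simp only [Nat.zero_add, iterate_succ_apply'] at this ⊢
    exact hm.adj this.symm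

/-- Without outgoing combs, every ray eventually leaves the paths of a linkage. -/
theorem Links.ray_eventually_avoids (h : D.Links q B) (hcomb : ¬ D.HasOutgoingComb)
    {R : ℕ → V} (hR : D.IsRay R) : ∃ N, ∀ n, N ≤ n → R n ∉ orbit q B := by
  classical
  by_contra! hcon
  apply hcomb
  let T : Set V := {b | b ∈ B ∧ ∃ k, q^[k] b ∈ Set.range R}
  -- Each path of the linkage is finite, so finitely many of them cannot cover infinitely many ray
  -- vertices.
  have hT : T.Infinite := by
    intro hfin
    have hJ : {n | R n ∈ orbit q B}.Infinite :=
      Set.infinite_of_forall_exists_gt fun N => by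
        obtain ⟨n, hn, hn'⟩ := hcon (N + 1)
        exact ⟨n, hn', by omega⟩
    refine hJ.image hR.1.injOn ((hfin.biUnion (t := fun b => orbit q {b}) ?_).subset ?_)
    · rintro b ⟨hb, -⟩
      obtain ⟨n, hn⟩ := h.reach b hb
      exact h.finite_orbit_singleton hn
    · rintro _ ⟨n, ⟨b, hb, k, hk⟩, rfl⟩
      exact Set.mem_biUnion (show b ∈ T from ⟨hb, k, n, hk.symm⟩) ⟨b, rfl, k, hk⟩
  -- The spikes are the final segments of the paths after their last visit to `R`; it exists because
  -- exits are absorbing and not on the ray.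
  have hlast : ∀ b ∈ T, ∃ k, q^[k] b ∈ Set.range R ∧ ∀ j, k < j → q^[j] b ∉ Set.range R := by
    rintro b ⟨hb, k, hk⟩
    obtain ⟨n, hn⟩ := h.reach b hb
    have hbd : ∀ j, n ≤ j → q^[j] b ∉ Set.range R := by
      rintro j hj ⟨i, hi⟩
      exact hR.not_mem_exits i (hi ▸ h.iterate_mem_exits hn hj)
    have hkn : k ≤ n := by
      by_contra hlt
      exact hbd k (by omega) hk
    refine ⟨Nat.findGreatest (fun k => q^[k] b ∈ Set.range R) n,
      Nat.findGreatest_spec (P := fun k => q^[k] b ∈ Set.range R) hkn hk, fun j hj => ?_⟩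
    rcases le_total j n with hjn | hjn
    · exact Nat.findGreatest_is_greatest hj hjn
    · exact hbd j hjn
  choose! k hk hk' using hlast
  have hinj : Set.InjOn (fun b => q^[k b] b) T := by
    intro b hb b' hb' hbb
    refine h.eq_of_iterate_eq hb.1 hb'.1 hbb ?_
    obtain ⟨n, hn⟩ := hk b hb
    exact hn ▸ hR.not_mem_exits n
  refine h.hasOutgoingComb hR (hT.image hinj) ?_ ?_ ?_
  · rintro _ ⟨b, hb, rfl⟩
    exact hk b hb
  · rintro _ ⟨b, hb, rfl⟩
    obtain ⟨n, hn⟩ := h.reach b hb.1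
    refine ⟨n, ?_⟩
    simp only [← iterate_add_apply]
    exact h.iterate_mem_exits hn (by omega)
  · rintro _ ⟨b, hb, rfl⟩ j
    simp only [← iterate_add_apply]
    exact hk' b hb _ (by omega)

/-! ### Linkages of maximal linkable sets -/

/-- `q` is the successor map of a linkage of a maximal linkable set `B`. -/
structure LinksBase (D : Dimaze V) (q : V → V) (B : Set V) : Prop extends D.Links q B where
  eq_self : ∀ x ∉ orbit q B, q x = x
  maximal : ∀ a ∉ B, ¬ D.Linkable (insert a B)

/-- Some vertex, not an exit, that `q` maps to `x`. -/
noncomputable def pred (D : Dimaze V) (q : V → V) (x : V) : V :=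
  open Classical in if h : ∃ y, y ∉ D.exits ∧ q y = x then h.choose else x

namespace LinksBase

/-- If nothing led into `x`, then `q` itself would link `insert x B`, against maximality. With
`injOn` and `avoid`, this makes `q` a bijection from the non-exits onto the complement of `B`,
inverted by `pred`. -/
theorem surj (h : D.LinksBase q B) {x : V} (hx : x ∉ B) : ∃ y, y ∉ D.exits ∧ q y = x := by
  by_contra! hcon
  refine h.maximal x hx (Links.linkable (m := q) ⟨h.toIsSuccMap, ?_, ?_⟩)
  · rintro y hy (hyx | hyB)
    · exact hcon y hy hyx
    · exact h.avoid y hy hyB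
  · rintro a (rfl | ha)
    · by_cases hax : a ∈ D.exits
      · exact ⟨0, hax⟩
      · have hmem : a ∈ orbit q B := by
          by_contra hna
          exact hcon a hax (h.eq_self a hna)
        obtain ⟨b, hb, n, rfl⟩ := hmem
        cases n with
        | zero => exact h.reach _ hb
        | succ n =>
          refine (hcon (q^[n] b) (h.iterate_not_mem_exits hax n.le_succ) ?_).elim
          rw [iterate_succ_apply']
    · exact h.reach a ha

theorem pred_not_mem_exits (h : D.LinksBase q B) {x : V} (hx : x ∉ B) :
    D.pred q x ∉ D.exits := by
  rw [pred, dif_pos (h.surj hx)]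
  exact (h.surj hx).choose_spec.1

theorem map_pred (h : D.LinksBase q B) {x : V} (hx : x ∉ B) : q (D.pred q x) = x := by
  rw [pred, dif_pos (h.surj hx)]
  exact (h.surj hx).choose_spec.2

theorem pred_map (h : D.LinksBase q B) {x : V} (hx : x ∉ D.exits) : D.pred q (q x) = x :=
  h.injOn (h.pred_not_mem_exits (h.avoid x hx)) hx (h.map_pred (h.avoid x hx))

theorem not_mem_base (_ : D.LinksBase q B) {x : V} (hx : x ∉ orbit q B) : x ∉ B :=
  fun hB => hx (subset_orbit q B hB)

theorem exits_subset_orbit (h : D.LinksBase q B) : D.exits ⊆ orbit q B := by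
  intro x hx
  by_cases hB : x ∈ B
  · exact subset_orbit q B hB
  · have h1 := h.map_pred hB
    by_contra hno
    have h2 : D.pred q x ∈ orbit q B := by
      by_contra h3
      have h4 := h.eq_self _ h3
      exact h.pred_not_mem_exits hB (by rw [← h4, h1]; exact hx)
    exact hno (h1 ▸ iterate_mem_orbit h2 1)

theorem not_mem_exits (h : D.LinksBase q B) {x : V} (hx : x ∉ orbit q B) : x ∉ D.exits :=
  fun hB => hx (h.exits_subset_orbit hB)

theorem pred_eq_self (h : D.LinksBase q B) {x : V} (hx : x ∉ orbit q B) : D.pred q x = x := by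
  have := h.pred_map (h.not_mem_exits hx)
  rwa [h.eq_self x hx] at this

end LinksBase

/-! ### The shifted dimaze -/

/-- The shift of the dimaze along the linkage with successor map `q`: the set `B` of linked
vertices becomes the set of exits, the edges of the linkage are reversed, and any other edge
leaving a vertex `v` of the linkage leaves `q v` instead. -/
def Links.shift (h : D.Links q B) : Dimaze V where
  Adj x y := x ≠ y ∧ ∃ v ∉ D.exits, q v = x ∧ (y = v ∨ D.Adj v y)
  exits := B
  loopless _ h := h.1 rfl
  exits_sink b hb y := by
    rintro ⟨-, v, hv, rfl, -⟩
    exact h.avoid v hv hb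

namespace LinksBase

theorem shift_adj_of_pred (h : D.LinksBase q B) {x y : V} (hx : x ∉ B) (hxy : x ≠ y)
    (hy : y = D.pred q x ∨ D.Adj (D.pred q x) y) : h.shift.Adj x y :=
  ⟨hxy, _, h.pred_not_mem_exits hx, h.map_pred hx, hy⟩

theorem shift_adj_map (h : D.LinksBase q B) {x y : V} (hx : x ∉ D.exits)
    (hxy : h.shift.Adj (q x) y) : y = x ∨ D.Adj x y := by
  obtain ⟨-, v, hv, hvx, hy⟩ := hxy
  rwa [h.injOn hv hx hvx] at hy

theorem shift_adj_pred (h : D.LinksBase q B) {x y : V} (hx : x ∉ B)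
    (hxy : h.shift.Adj x y) : y = D.pred q x ∨ D.Adj (D.pred q x) y :=
  h.shift_adj_map (h.pred_not_mem_exits hx) (by rwa [h.map_pred hx])

theorem shift_adj_off (h : D.LinksBase q B) {x y : V} (hx : x ∉ orbit q B)
    (hxy : h.shift.Adj x y) : D.Adj x y := by
  have := h.shift_adj_pred (h.not_mem_base hx) hxy
  rw [h.pred_eq_self hx] at this
  exact this.resolve_left fun h' => hxy.1 h'.symm

/-- If the iterates of `m` starting in `a` never reach an exit, then they eventually avoid the
linkage. -/
theorem eventually_avoids (h : D.LinksBase q B) (hcomb : ¬ D.HasOutgoingComb)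
    (hm : D.IsSuccMap m) {a : V} (ha : ∀ x ∉ D.exits, m x ≠ a) (hn : ∀ n, m^[n] a ∉ D.exits) :
    ∃ N, ∀ n, m^[n] a ≠ m^[n + 1] a ∧ (N ≤ n → m^[n] a ∉ orbit q B) := by
  have hR := hm.isRay ha hn
  obtain ⟨N, hN⟩ := h.ray_eventually_avoids hcomb hR
  exact ⟨N, fun n => ⟨fun hne => absurd (hR.1 hne) (by omega), hN n⟩⟩

/-- A ray of the shifted dimaze eventually leaves the linkage: otherwise exchanging along the ray
links a set larger than `B`. -/
theorem shift_ray_eventually_avoids (h : D.LinksBase q B) (hcomb : ¬ D.HasOutgoingComb)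
    {R : ℕ → V} (hR : h.shift.IsRay R) : ∃ N, ∀ n, N ≤ n → R n ∉ orbit q B := by
  classical
  have hRB : ∀ n, R n ∉ B := hR.not_mem_exits
  -- Each step of `R` in the shift is the reversal of a `q`-edge or an edge leaving the
  -- `q`-predecessor. The exchanged map skips over `R n`, from its predecessor straight to `R (n +
  -- 1)`, which frees `R 0` as a new starting vertex.
  let m : V → V := fun x => if hx : ∃ n, q x = R n ∧ x ∉ D.exits then R (hx.choose + 1) else q x
  have hm1 : ∀ x n, x ∉ D.exits → q x = R n → m x = R (n + 1) := by
    intro x n hx hn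
    have hex : ∃ n, q x = R n ∧ x ∉ D.exits := ⟨n, hn, hx⟩
    have : m x = R (hex.choose + 1) := dif_pos hex
    rw [this, hR.1 (hex.choose_spec.1.symm.trans hn)]
  have hm2 : ∀ x, (¬ ∃ n, q x = R n ∧ x ∉ D.exits) → m x = q x := fun x hx => dif_neg hx
  have hm : D.IsSuccMap m := by
    constructor
    · intro x
      by_cases hx : ∃ n, q x = R n ∧ x ∉ D.exits
      · obtain ⟨n, hn, hx⟩ := hx
        rw [hm1 x n hx hn]
        exact h.shift_adj_map hx (hn ▸ hR.2 n)
      · rw [hm2 x hx]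
        exact h.step x
    · have mixed : ∀ x y, x ∉ D.exits → y ∉ D.exits → (∃ n, q x = R n ∧ x ∉ D.exits) →
          (¬ ∃ n, q y = R n ∧ y ∉ D.exits) → m x ≠ m y := by
        rintro x y hx hy ⟨n, hn, -⟩ hny he
        rw [hm1 x n hx hn, hm2 y hny] at he
        exact hny ⟨n + 1, he.symm, hy⟩
      intro x hx y hy hxy
      by_cases h1 : ∃ n, q x = R n ∧ x ∉ D.exits <;> by_cases h2 : ∃ n, q y = R n ∧ y ∉ D.exits
      · obtain ⟨n, hn, -⟩ := h1
        obtain ⟨k, hk, -⟩ := h2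
        rw [hm1 x n hx hn, hm1 y k hy hk] at hxy
        obtain rfl : n = k := by
          have := hR.1 hxy
          omega
        exact h.injOn hx hy (hn.trans hk.symm)
      · exact (mixed x y hx hy h1 h2 hxy).elim
      · exact (mixed y x hy hx h2 h1 hxy.symm).elim
      · rw [hm2 x h1, hm2 y h2] at hxy
        exact h.injOn hx hy hxy
  have havoid : ∀ x ∉ D.exits, m x ∉ insert (R 0) B := by
    intro x hx
    by_cases h1 : ∃ n, q x = R n ∧ x ∉ D.exits
    · obtain ⟨n, hn, -⟩ := h1
      rw [hm1 x n hx hn]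
      rintro (he | he)
      · exact absurd (hR.1 he) (by omega)
      · exact hRB _ he
    · rw [hm2 x h1]
      rintro (he | he)
      · exact h1 ⟨0, he, hx⟩
      · exact h.avoid x hx he
  have hreach : ∃ a ∈ insert (R 0) B, ∀ n, m^[n] a ∉ D.exits := by
    by_contra! hreach
    exact h.maximal (R 0) (hRB 0) (Links.linkable ⟨hm, havoid, hreach⟩)
  obtain ⟨a, ha, han⟩ := hreach
  obtain ⟨N, hN⟩ := h.eventually_avoids hcomb hm (fun x hx he => havoid x hx (he ▸ ha)) han
  have hoff : ∀ k, m^[N + k] a ∉ orbit q B := fun k => (hN _).2 (by omega)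
  have hfix : ∀ k, q (m^[N + k] a) = m^[N + k] a := fun k => h.eq_self _ (hoff k)
  -- Off the linkage `q` fixes every vertex, so `m` can move one only if it lies on `R`. From there
  -- on the trajectory follows `R`.
  obtain ⟨i, hi⟩ : ∃ i, m^[N] a = R i := by
    by_contra hcon
    refine (hN N).1 ?_
    rw [iterate_succ_apply', hm2 _ ?_]
    · exact (hfix 0).symm
    · rintro ⟨n, hn, -⟩
      exact hcon ⟨n, (hfix 0).symm.trans hn⟩
  have hall : ∀ k, m^[N + k] a = R (i + k) := by
    intro k
    induction k with
    | zero => exact hi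
    | succ k ih =>
      rw [← Nat.add_assoc, iterate_succ_apply', hm1 _ (i + k) (han _) (by rw [hfix, ih])]
      rfl
  refine ⟨i, fun n hn => ?_⟩
  obtain ⟨k, rfl⟩ := Nat.exists_eq_add_of_le hn
  exact hall k ▸ hoff k

/-- A successor map of the shifted dimaze induces one of the dimaze. -/
theorem links_of_shift (h : D.LinksBase q B) (hcomb : ¬ D.HasOutgoingComb)
    (hm : h.shift.Links m A) (hA : ∀ x, m x ≠ x → x ∈ orbit m A) :
    ∃ m', D.Links m' A ∧ (∀ x ∉ D.exits, m' x = m (q x)) := by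
  classical
  let m' : V → V := fun x => if x ∈ D.exits then x else m (q x)
  have h1 : ∀ x ∉ D.exits, m' x = m (q x) := fun x hx => if_neg hx
  have h0 : ∀ x ∈ D.exits, m' x = x := fun x hx => if_pos hx
  have hm' : D.IsSuccMap m' := by
    constructor
    · intro x
      by_cases hx : x ∈ D.exits
      · exact Or.inl (h0 x hx)
      · rw [h1 x hx]
        by_cases he : m (q x) = q x
        · rw [he]
          exact h.step x
        · exact h.shift_adj_map hx (hm.adj he)
    · intro x hx y hy hxy
      rw [h1 x hx, h1 y hy] at hxy
      exact h.injOn hx hy (hm.injOn (h.avoid x hx) (h.avoid y hy) hxy)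
  have havoid : ∀ x ∉ D.exits, m' x ∉ A := by
    intro x hx
    rw [h1 x hx]
    exact hm.avoid _ (h.avoid x hx)
  refine ⟨m', ⟨hm', havoid, ?_⟩, h1⟩
  intro a ha
  by_contra! han
  obtain ⟨N, hN⟩ := h.eventually_avoids hcomb hm' (fun x hx he => havoid x hx (he ▸ ha)) han
  have hoff : ∀ k, m'^[N + k] a ∉ orbit q B := fun k => (hN _).2 (by omega)
  have hstep : ∀ k, m'^[N + k + 1] a = m (m'^[N + k] a) := by
    intro k
    rw [iterate_succ_apply', h1 _ (han _), h.eq_self _ (hoff k)]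
  have hall : ∀ k, m'^[N + k] a = m^[k] (m'^[N] a) := by
    intro k
    induction k with
    | zero => rfl
    | succ k ih => rw [← Nat.add_assoc, hstep, ih, iterate_succ_apply']
  -- The tail is moved by `m`, so it lies on the `m`-path of some `c` in `A`. That path ends in `B`,
  -- which the tail avoids.
  obtain ⟨c, hc, j, hj⟩ := hA (m'^[N] a) fun he => (hN N).1 (by
    have := hstep 0
    simp only [Nat.add_zero] at this
    rw [this, he])
  obtain ⟨n, hn⟩ := hm.reach c hc
  have hB : m^[n + j] c ∈ B := hm.iterate_mem_exits hn (by omega)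
  rw [iterate_add_apply, hj, ← hall] at hB
  exact h.not_mem_base (hoff n) hB

/-- A successor map of the dimaze induces one of the shifted dimaze. -/
theorem shift_links (h : D.LinksBase q B) (hcomb : ¬ D.HasOutgoingComb)
    (hm : D.Links m A) (hA : ∀ x, m x ≠ x → x ∈ orbit m A) :
    ∃ m', h.shift.Links m' A := by
  classical
  let m' : V → V := fun x => if x ∈ B then x else m (D.pred q x)
  have h1 : ∀ x ∉ B, m' x = m (D.pred q x) := fun x hx => if_neg hx
  have h0 : ∀ x ∈ B, m' x = x := fun x hx => if_pos hx
  have hm' : h.shift.IsSuccMap m' := by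
    constructor
    · intro x
      by_cases hx : x ∈ B
      · exact Or.inl (h0 x hx)
      · by_cases he : m' x = x
        · exact Or.inl he
        · refine Or.inr (h.shift_adj_of_pred hx (Ne.symm he) ?_)
          rw [h1 x hx]
          exact hm.step _
    · intro x hx y hy hxy
      rw [h1 x hx, h1 y hy] at hxy
      have := hm.injOn (h.pred_not_mem_exits hx) (h.pred_not_mem_exits hy) hxy
      rw [← h.map_pred hx, this, h.map_pred hy]
  have havoid : ∀ x ∉ B, m' x ∉ A := by
    intro x hx
    rw [h1 x hx]
    exact hm.avoid _ (h.pred_not_mem_exits hx)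
  refine ⟨m', ⟨hm', havoid, ?_⟩⟩
  intro a ha
  by_contra! han
  have hR := hm'.isRay (fun x hx he => havoid x hx (he ▸ ha)) han
  obtain ⟨N, hN⟩ := h.shift_ray_eventually_avoids hcomb hR
  have hoff : ∀ k, m'^[N + k] a ∉ orbit q B := fun k => hN _ (by omega)
  have hstep : ∀ k, m'^[N + k + 1] a = m (m'^[N + k] a) := by
    intro k
    rw [iterate_succ_apply', h1 _ (han _), h.pred_eq_self (hoff k)]
  have hall : ∀ k, m'^[N + k] a = m^[k] (m'^[N] a) := by
    intro k
    induction k with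
    | zero => rfl
    | succ k ih => rw [← Nat.add_assoc, hstep, ih, iterate_succ_apply']
  obtain ⟨c, hc, j, hj⟩ := hA (m'^[N] a) fun he => by
    have := hstep 0
    simp only [Nat.add_zero, he] at this
    exact absurd (hR.1 this) (by omega)
  obtain ⟨n, hn⟩ := hm.reach c hc
  have hB : m^[n + j] c ∈ D.exits := hm.iterate_mem_exits hn (by omega)
  rw [iterate_add_apply, hj, ← hall] at hB
  exact h.not_mem_exits (hoff n) hB

theorem shift_linkable_iff (h : D.LinksBase q B) (hcomb : ¬ D.HasOutgoingComb) :
    h.shift.Linkable A ↔ D.Linkable A := by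
  constructor
  · intro hA
    obtain ⟨m, hm, hmA⟩ := hA.exists_links
    obtain ⟨m', hm', -⟩ := h.links_of_shift hcomb hm hmA
    exact hm'.linkable
  · intro hA
    obtain ⟨m, hm, hmA⟩ := hA.exists_links
    obtain ⟨m', hm'⟩ := h.shift_links hcomb hm hmA
    exact hm'.linkable

/-- Far out, the spine leaves the linkage and is a ray of `D`. The spikes attached there form a
linkage of the shift, and its translation to `D` gives a comb on the same tail. -/
theorem shift_not_hasOutgoingComb (h : D.LinksBase q B) (hcomb : ¬ D.HasOutgoingComb) :
    ¬ h.shift.HasOutgoingComb := by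
  rintro ⟨R, S, hR, hS, hlink, hSR⟩
  obtain ⟨N, hN⟩ := h.shift_ray_eventually_avoids hcomb hR
  let T : Set h.shift.DiPath := {p | p ∈ S ∧ ∃ n, p.ini = R (N + n)}
  have hini : ∀ p : h.shift.DiPath, p.ini ∈ p.vertexSet := fun p => List.head_mem _
  have hinj : Set.InjOn DiPath.ini S := by
    intro p hp p' hp' hpp
    by_contra hne
    exact Set.disjoint_left.1 (hlink.1 hp hp' hne) (hini p) (hpp ▸ hini p')
  have hT : T.Infinite := by
    have hfin : (S \ T).Finite := by
      refine Set.Finite.of_finite_image (f := DiPath.ini)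
        (((Set.finite_Iio N).image R).subset ?_) (hinj.mono Set.sdiff_subset)
      rintro _ ⟨p, ⟨hp, hpT⟩, rfl⟩
      obtain ⟨n, hn⟩ : p.ini ∈ Set.range R :=
        ((hSR p hp).2.symm ▸ rfl : p.ini ∈ p.vertexSet ∩ Set.range R).2
      refine ⟨n, ?_, hn⟩
      by_contra hlt
      rw [Set.mem_Iio, not_lt] at hlt
      obtain ⟨d, rfl⟩ := Nat.exists_eq_add_of_le hlt
      exact hpT ⟨hp, d, hn.symm⟩
    intro hTfin
    exact hS ((hfin.union hTfin).subset fun p hp => by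
      by_cases hpT : p ∈ T
      · exact Or.inr hpT
      · exact Or.inl ⟨hp, hpT⟩)
  have hTlink : h.shift.IsLinkage T :=
    ⟨hlink.1.subset fun p hp => hp.1, fun p hp => hlink.2 p hp.1⟩
  obtain ⟨m, hm, hmT⟩ := hTlink.exists_links
  obtain ⟨m', hm', hmm'⟩ := h.links_of_shift hcomb hm fun x hx => (hmT x hx).1
  have hoff : ∀ n, R (N + n) ∉ orbit q B := fun n => hN _ (by omega)
  have hray : D.IsRay (fun n => R (N + n)) :=
    ⟨(hR.tail N).1, fun n => h.shift_adj_off (hoff n) ((hR.tail N).2 n)⟩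
  have hfix : ∀ n, R (N + n) ∉ DiPath.ini '' T → m' (R (N + n)) = R (N + n) := by
    intro n hn
    rw [hmm' _ (hray.not_mem_exits n), h.eq_self _ (hoff n)]
    by_contra hne
    obtain ⟨-, p, hp, hpR⟩ := hmT _ hne
    have : R (N + n) ∈ p.vertexSet ∩ Set.range R := ⟨hpR, _, rfl⟩
    rw [(hSR p hp.1).2] at this
    exact hn ⟨p, hp, this.symm⟩
  refine hcomb (hm'.hasOutgoingComb hray (hT.image (hinj.mono fun p hp => hp.1)) ?_ hm'.reach ?_)
  · rintro _ ⟨p, ⟨-, n, hn⟩, rfl⟩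
    exact ⟨n, hn.symm⟩
  · rintro s hs k ⟨n, hn⟩
    have hex : m'^[k + 1] s ∉ D.exits := hn ▸ hray.not_mem_exits n
    have hnT : R (N + n) ∉ DiPath.ini '' T := by
      simp only at hn
      rw [hn, iterate_succ_apply']
      exact hm'.avoid _ (hm'.iterate_not_mem_exits hex k.le_succ)
    -- A ray vertex that starts no spike is fixed by `m'`, so by injectivity only a trajectory
    -- already sitting there can reach it.
    have hback : ∀ j, j ≤ k + 1 → m'^[j] s = R (N + n) → s = R (N + n) := by
      intro j
      induction j with
      | zero => exact fun _ he => he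
      | succ j ih =>
        intro hj he
        refine ih (by omega) (hm'.injOn (hm'.iterate_not_mem_exits hex (by omega))
          (hray.not_mem_exits n) ?_)
        rw [← iterate_succ_apply' m' j s, he, hfix n hnT]
    exact hnT (hback _ le_rfl hn.symm ▸ hs)

end LinksBase

/-! ### Contracting a set of exits -/

/-- Delete the edges at the vertices of `C` and turn exits in `C` into ordinary vertices. -/
def isolate (D : Dimaze V) (C : Set V) : Dimaze V where
  Adj x y := D.Adj x y ∧ x ∉ C ∧ y ∉ C
  exits := D.exits \ C
  loopless x h := D.loopless x h.1
  exits_sink b hb y h := D.exits_sink b hb.1 y h.1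

/-- The same successor map serves both sides: in a linkage of `A ∪ C` the exits in `C` are taken by
trivial paths, so no path from `A` meets `C`. -/
theorem isolate_linkable_iff {C : Set V} (hC : C ⊆ D.exits) :
    (D.isolate C).Linkable A ↔ Disjoint A C ∧ D.Linkable (A ∪ C) := by
  constructor
  · intro hA
    obtain ⟨m, hm, -⟩ := hA.exists_links
    have hfix : ∀ x ∈ C, m x = x := fun x hx =>
      (hm.step x).resolve_right fun h => h.2.1 hx
    refine ⟨Set.disjoint_left.2 fun x hxA hxC => ?_, Links.linkable (m := m) ⟨⟨?_, ?_⟩, ?_, ?_⟩⟩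
    · exact hm.avoid x (fun h => h.2 hxC) (by rwa [hfix x hxC])
    · exact fun x => (hm.step x).imp id fun h => h.1
    · exact fun x hx y hy => hm.injOn (fun h => hx h.1) (fun h => hy h.1)
    · rintro x hx (h | h)
      · exact hm.avoid x (fun h' => hx h'.1) h
      · rcases hm.step x with he | he
        · exact hx (hC (he ▸ h))
        · exact he.2.2 h
    · rintro a (ha | ha)
      · obtain ⟨n, hn⟩ := hm.reach a ha
        exact ⟨n, hn.1⟩
      · exact ⟨0, hC ha⟩
  · rintro ⟨hdisj, hA⟩
    obtain ⟨m, hm, -⟩ := hA.exists_links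
    refine Links.linkable (m := m) ⟨⟨?_, ?_⟩, ?_, ?_⟩
    · intro x
      rcases hm.step x with he | he
      · exact Or.inl he
      · have hx : x ∉ D.exits := fun h => D.exits_sink x h _ he
        exact Or.inr ⟨he, fun h => hx (hC h), fun h => hm.avoid x hx (Or.inr h)⟩
    · have hcase : ∀ x ∉ (D.isolate C).exits, x ∈ D.exits → x ∈ C := by
        intro x hx hx'
        by_contra hxC
        exact hx ⟨hx', hxC⟩
      have mixed : ∀ x y, x ∉ D.exits → y ∈ C → m x ≠ m y := by
        intro x y hx hy he
        rw [hm.fixed (hC hy)] at he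
        exact hm.avoid x hx (he ▸ Or.inr hy)
      intro x hx y hy hxy
      by_cases h1 : x ∈ D.exits <;> by_cases h2 : y ∈ D.exits
      · rwa [hm.fixed h1, hm.fixed h2] at hxy
      · exact (mixed y x h2 (hcase x hx h1) hxy.symm).elim
      · exact (mixed x y h1 (hcase y hy h2) hxy).elim
      · exact hm.injOn h1 h2 hxy
    · intro x hx hxA
      by_cases h1 : x ∈ D.exits
      · rw [hm.fixed h1] at hxA
        exact hx ⟨h1, Set.disjoint_left.1 hdisj hxA⟩
      · exact hm.avoid x h1 (Or.inl hxA)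
    · intro a ha
      obtain ⟨n, hn⟩ := hm.reach a (Or.inl ha)
      refine ⟨n, hn, ?_⟩
      clear hn
      induction n with
      | zero => exact Set.disjoint_left.1 hdisj ha
      | succ n ih =>
        intro h
        rw [iterate_succ_apply'] at h
        by_cases h1 : m^[n] a ∈ D.exits
        · rw [hm.fixed h1] at h
          exact ih h
        · exact hm.avoid _ h1 (Or.inr h)

theorem isolate_not_hasOutgoingComb {C : Set V} (h : ¬ D.HasOutgoingComb) :
    ¬ (D.isolate C).HasOutgoingComb := by
  rintro ⟨R, S, hR, hS, ⟨hdisj, hter⟩, hSR⟩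
  let f : (D.isolate C).DiPath → D.DiPath := fun p =>
    ⟨p.verts, p.ne_nil, p.chain.imp fun _ _ h => h.1, p.nodup⟩
  have hf : Injective f := fun p p' hp => DiPath.ext (congrArg (DiPath.verts (D := D)) hp :)
  refine h ⟨R, f '' S, ⟨hR.1, fun n => (hR.2 n).1⟩, hS.image hf.injOn, ⟨?_, ?_⟩, ?_⟩
  · rintro _ ⟨p, hp, rfl⟩ _ ⟨p', hp', rfl⟩ hne
    exact hdisj hp hp' fun he => hne (he ▸ rfl)
  · rintro _ ⟨p, hp, rfl⟩
    exact (hter p hp).1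
  · rintro _ ⟨p, hp, rfl⟩
    exact hSR p hp

/-! ### Passing to matroids and their minors -/

theorem Defines.exists_linksBase {N : Matroid V} (hN : D.Defines N) (hB : N.IsBase B) :
    ∃ q, D.LinksBase q B := by
  obtain ⟨q, hq, hq'⟩ := ((hN.2 B).1 hB.indep).exists_links
  refine ⟨q, hq, fun x hx => by_contra fun hne => hx (hq' x hne), fun a ha hl => ha ?_⟩
  rw [hB.eq_of_subset_indep ((hN.2 _).2 hl) (Set.subset_insert a B)]
  exact Set.mem_insert a B

/-- Contracting an independent set preserves presentability without outgoing combs. -/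
theorem Defines.exists_contract {N : Matroid V} (hN : D.Defines N) (hD : ¬ D.HasOutgoingComb)
    {C : Set V} (hC : N.Indep C) :
    -- Restricting to `Set.univ` puts `C` back as loops, since the vertex set is unchanged.
    ∃ D' : Dimaze V, ¬ D'.HasOutgoingComb ∧ D'.Defines ((N.contract C).restrict Set.univ) := by
  obtain ⟨B, hB, hCB⟩ := hC.exists_isBase_superset
  obtain ⟨q, hq⟩ := hN.exists_linksBase hB
  refine ⟨hq.shift.isolate C,
    isolate_not_hasOutgoingComb (hq.shift_not_hasOutgoingComb hD), rfl, fun I => ?_⟩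
  rw [isolate_linkable_iff hCB, hq.shift_linkable_iff hD, Matroid.restrict_indep_iff,
    hC.contract_indep_iff, hN.2]
  simp

theorem presents_iff {α : Type u} {M : Matroid α} :
    D.Presents M ↔ ∃ (N : Matroid V) (f : M.E → V), D.Defines N ∧ Injective f ∧
      ∀ I : Set M.E, M.Indep (Subtype.val '' I) ↔ N.Indep (f '' I) := by
  constructor
  · rintro ⟨N, X, hN, e, he⟩
    refine ⟨N, fun x => (e x).1, hN, Subtype.val_injective.comp e.injective, fun I => ?_⟩
    rw [he, Matroid.restrict_indep_iff, Set.image_image]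
    refine and_iff_left ?_
    rintro _ ⟨x, -, rfl⟩
    exact (e x).2
  · rintro ⟨N, f, hN, hf, h⟩
    refine ⟨N, Set.range f, hN, Equiv.ofInjective f hf, fun I => ?_⟩
    rw [h, Matroid.restrict_indep_iff, Set.image_image]
    exact (and_iff_left (Set.image_subset_range f I)).symm

end Dimaze

theorem theorem2p10 {α : Type u} (M N : Matroid α)
    (hM : IsOutgoingCombFreeGammoid.{u, v} M) (hNM : Matroid.IsMinor N M) :
    IsOutgoingCombFreeGammoid.{u, v} N := by
  obtain ⟨V, D, hD, hpres⟩ := hM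
  obtain ⟨L, f, hL, hf, hfM⟩ := Dimaze.presents_iff.1 hpres
  -- After a basis of `C` is contracted, the rest of `C` consists of loops and can be deleted.
  obtain ⟨C, R, hC, rfl⟩ : ∃ C R, M.Indep C ∧ N = (M.contract C).delete R := by
    obtain ⟨C, R, rfl⟩ := hNM
    obtain ⟨I, hI⟩ := M.exists_isBasis' C
    exact ⟨I, C \ I ∪ R, hI.indep, by
      rw [hI.contract_eq_contract_delete, Matroid.delete_delete]⟩
  have hCE : Subtype.val '' (Subtype.val ⁻¹' C : Set M.E) = C := by
    rw [Subtype.image_preimage_coe]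
    exact Set.inter_eq_right.2 hC.subset_ground
  obtain ⟨D', hD', hL'⟩ := hL.exists_contract hD ((hfM (Subtype.val ⁻¹' C)).1 (by rwa [hCE]))
  have hsub : ((M.contract C).delete R).E ⊆ M.E := hNM.subset
  refine ⟨V, D', hD', Dimaze.presents_iff.2 ⟨_, f ∘ Set.inclusion hsub, hL',
    hf.comp (Set.inclusion_injective hsub), fun I => ?_⟩⟩
  have hIR : Disjoint (Subtype.val '' I) R := by
    rw [Set.disjoint_left]
    rintro _ ⟨x, -, rfl⟩
    exact x.2.2
  have hIC : Disjoint (Subtype.val '' I) C := by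
    rw [Set.disjoint_left]
    rintro _ ⟨x, -, rfl⟩
    exact x.2.1.2
  have hfIC : Disjoint (f ∘ Set.inclusion hsub '' I) (f '' (Subtype.val ⁻¹' C)) := by
    rw [Set.image_comp, Set.disjoint_image_iff hf, Set.disjoint_left]
    rintro _ ⟨x, -, rfl⟩
    exact x.2.1.2
  have hCf : L.Indep (f '' (Subtype.val ⁻¹' C)) := (hfM _).1 (by rwa [hCE])
  have himg : Subtype.val '' (Set.inclusion hsub '' I) = Subtype.val '' I := by
    rw [Set.image_image]
  rw [Set.image_comp] at hfIC ⊢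
  rw [Matroid.delete_indep_iff, hC.contract_indep_iff, Matroid.restrict_indep_iff,
    hCf.contract_indep_iff, ← Set.image_union, ← hfM, Set.image_union, hCE, himg]
  exact ⟨fun h => ⟨⟨hfIC, h.1.2⟩, Set.subset_univ _⟩, fun h => ⟨⟨hIC, h.1.2⟩, hIR⟩⟩
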